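/- **Games.** A game is played on a directed graph whose vertices are divided between Player 0 and Player 1; the owner of the current vertex chooses the next edge. In a request-response game with pairs $(P_j,R_j)_{1\le j\le K}$, a play $\varrho$ is won by Player 0 iff for all $j,i$ with $\varrho(i)\in P_j$ there is $i'\ge i$ with $\varrho(i')\in R_j$. In a Büchi game with set $F$ of final vertices, a play is won by Player 0 iff it visits $F$ infinitely often. **The games $\Gamma_k$.** Let $k\ge 1$. The graph $G_k=(V,E)$ has the vertices $a_i,p_i,p'_i,w_i,r_i,r'_i$ $(1\le i\le k)$, $x$, $y$; put $v:=a_1$ and $w:=w_1$. The edges are $a_i\to p_i$, $a_i\to p'_i$; $p_i,p'_i\to a_{i+1}$ for $i<k$; $p_k,p'_k\to w_1$; $w_i\to r_i$, $w_i\to r'_i$; $r_i,r'_i\to w_{i+1}$ for $i<k$; $r_k,r'_k\to x$; $x\to y$; $y\to y$. Player 0 owns the vertices $w_i$, Player 1 all others. The $K=2k+1$ request-response pairs are, in this order, $(P_0,R_0),(P_1,R_1),(P'_1,R'_1),\dots,(P_k,R_k),(P'_k,R'_k)$ with $P_0=\{v\}$, $R_0=\{w,y\}$, $P_i=\{p_i\}$,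 $P'_i=\{p'_i\}$, $R_i=\{r_i,y\}$, $R'_i=\{r'_i,y\}$. **The Büchi game $\Gamma'_k$.** Renumber the pairs as $1,\dots,K$. The vertex set is $S\times V$ with $S=2^{\{1,\dots,K\}}\times\{1,\dots,K\}\times\{0,1\}$; there is an edge from $(P,i,b,u)$ to $(P',i',b',u')$ iff $(u,u')\in E$, $P'=(P\cup\{j: u\in P_j\})\setminus\{j: u\in R_j\}$, $i'=i$ if $i\in P'$ and $i'=(i \bmod K)+1$ otherwise, and $b'=1$ iff $i=K$ and $i'=1$. The owner of a vertex is that of its $V$-component, and the final vertices are those with flag $b=1$. A positional strategy of Player 0 in $\Gamma'_k$ is an *attractor strategy* if at every vertex of Player 0 that lies outside the set $\mathrm{Recur}_0$ of the final vertices from which Player 0 can force infinitely many visits to final vertices, but in the attractor of this set, it decreases the attractor distance to this set, and if from vertices in $\mathrm{Recur}_0$ it stays in the attractor. Together with the memory update of $\Gamma'_k$, started in $(\emptyset,1,0)$, a positional strategy $f'$ in $\Gamma'_k$ is a Mealy automaton with state set $S$, which defines a strategy $f$ in $\Gamma_k$. **The reduced game.** The game automaton $\mathcal A$ of $\Gamma'_k$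 reads sequences of vertices of $G_k$. Its states are the elements of $S\times V$, an initial state $q_0$ and a rejecting sink. It moves from $q_0$ to $(\emptyset,1,0,u')$ when reading $u'$, from $(s,u)$ along the edge of $\Gamma'_k$ with target in $S\times\{u'\}$ when reading $u'$ with $(u,u')\in E$, and otherwise into the sink. Let $\mathcal A^-$ be $\mathcal A$ without the sink (which is never entered on plays of $G_k$). The closure of $\mathcal A^-$ has as final states the least set that contains the final states and every state all of whose successors it contains. For an equivalence relation $\approx$ on $S\times V$ let $s_1\approx_S s_2$ iff $(s_1,u)\approx(s_2,u)$ for all $u\in V$. The reduced game $\Gamma''_k$, with graph $G''_k$ on $(S/{\approx_S})\times V$, is the game of the quotient of $\mathcal A$ by $\approx_S$: for $(u,u')\in E$ the $u'$-successor of $([s],u)$ is $([s_{\min}],u')$, where $s_{\min}$ is the least memory content, for a fixed total order of $S$, that is reached from some $(\hat s,u)$ with $\hat s\approx_S s$ when reading $u'$. Here $\approx$ is direct bisimilarity in the closure of $\mathcal A^-$ (final states are visited at the same times), or mutual delayed simulation in $\mathcal A^-$ (each visit to a final state in one run is answered by a visit at the same time or later in the other). **Theorem.** For every $k\ge1$,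 $\Gamma_k$ is simulated by $\Gamma'_k$ with initial memory content $(\emptyset,1,0)$ (plays lift uniquely, and the winner is the same), and Player 0 wins $\Gamma_k$ from $v$. Moreover: 1. Attractor strategies in $\Gamma'_k$ exist. Every attractor strategy $f'_k$ is winning for Player 0 from $(\emptyset,1,0,v)$ in $\Gamma'_k$, and the strategy $f_k$ defined by it is winning for Player 0 from $v$ in $\Gamma_k$. Every Mealy automaton whose outputs agree with $f_k$ on the plays from $v$ that are played according to $f_k$ has at least $2^k$ states. 2. Every infinite path in $\Gamma'_k$, from any vertex, visits $(\emptyset,1,1,y)$ infinitely often; all states of $\mathcal A^-$ are final in its closure; and for each of the two choices of $\approx$ and each total order of $S$, the reduced game graph $G''_k$ has exactly one memory content, i.e. $|S/{\approx_S}|=1$. -/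

import Mathlib

open Filter

/-! ### Games on graphs -/

/-- A game arena: a directed graph whose vertices are partitioned into the set `V₀` of the
vertices of Player 0 and its complement, the vertices of Player 1. -/
structure Arena (V : Type) where
  V₀ : Set V
  E : V → V → Prop

/-- An infinite game: an arena with the set of the plays won by Player 0. -/
structure Game (V : Type) extends Arena V where
  win : Set (ℕ → V)

/-- Infinite paths (plays). -/
def Arena.IsPath {V : Type} (G : Arena V) (ρ : ℕ → V) : Prop :=
  ∀ n, G.E (ρ n) (ρ (n + 1))

/-- A strategy gets the past of the play (in chronological order) and the current vertex; only its
values at vertices of Player 0 matter. -/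
abbrev Strategy (V : Type) := List V → V → V

/-- The past `ρ(0) ⋯ ρ(n-1)` of a play at time `n`. -/
def past {V : Type} (ρ : ℕ → V) (n : ℕ) : List V := (List.range n).map ρ

/-- At every play prefix that ends in a vertex of Player 0, the strategy chooses an edge. -/
def Arena.IsStrategy {V : Type} (G : Arena V) (f : Strategy V) : Prop :=
  ∀ (h : List V) (v : V), v ∈ G.V₀ → (h ++ [v]).IsChain G.E → G.E v (f h v)

/-- The play `ρ` is played according to the strategy `f` of Player 0. -/
def Arena.Conforms {V : Type} (G : Arena V) (f : Strategy V) (ρ : ℕ → V) : Prop :=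
  ∀ n, ρ n ∈ G.V₀ → ρ (n + 1) = f (past ρ n) (ρ n)

def Game.IsWinningFrom {V : Type} (Γ : Game V) (f : Strategy V) (v : V) : Prop :=
  Γ.IsStrategy f ∧ ∀ ρ, Γ.IsPath ρ → ρ 0 = v → Γ.Conforms f ρ → ρ ∈ Γ.win

/-- Player 0 wins the game from `v`. -/
def Game.Wins {V : Type} (Γ : Game V) (v : V) : Prop :=
  ∃ f, Γ.IsWinningFrom f v

/-- The strategy given by a positional strategy. -/
def positional {V : Type} (g : V → V) : Strategy V := fun _ v => g v

/-- Mealy automata with set `M` of states (memory contents) that read the vertices of a play and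
output the next moves. -/
structure Mealy (V M : Type*) where
  init : M
  step : M → V → M
  out : M → V → V

/-- The strategy defined by a Mealy automaton. -/
def Mealy.toStrategy {V M : Type*} (C : Mealy V M) : List V → V → V :=
  fun h v => C.out (h.foldl C.step C.init) v

/-- The Mealy automaton `C` implements the strategy `f` for Player 0 from `v`: on the plays from `v`
that are played according to `f`, it outputs the moves of `f`. -/
def Mealy.Implements {V : Type} {M : Type*} (C : Mealy V M) (G : Arena V) (f : Strategy V) (v : V) :
    Prop :=
  ∀ ρ, G.IsPath ρ → ρ 0 = v → G.Conforms f ρ →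
    ∀ n, ρ n ∈ G.V₀ → C.toStrategy (past ρ n) (ρ n) = f (past ρ n) (ρ n)

/-- The game `Γ` is simulated by the game `Γ'` over the vertex set `S × V`, with initial memory
content `s₀`. -/
structure Simulates {V S : Type} (Γ : Game V) (s₀ : S) (Γ' : Game (S × V)) : Prop where
  owner : ∀ s v, (s, v) ∈ Γ'.V₀ ↔ v ∈ Γ.V₀
  exists_update : ∀ s v v', Γ.E v v' → ∃ s', Γ'.E (s, v) (s', v')
  unique_update : ∀ s v s₁ v₁ s₂ v₂,
    Γ'.E (s, v) (s₁, v₁) → Γ'.E (s, v) (s₂, v₂) → s₁ = s₂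
  edge : ∀ s v s' v', Γ'.E (s, v) (s', v') → Γ.E v v'
  win_iff : ∀ ρ : ℕ → V, ∀ ρ' : ℕ → S × V, Γ.IsPath ρ → Γ'.IsPath ρ' →
    ρ' 0 = (s₀, ρ 0) → (∀ n, (ρ' n).2 = ρ n) → (ρ ∈ Γ.win ↔ ρ' ∈ Γ'.win)

/-! ### Büchi games and attractor strategies -/

structure BuchiGame (V : Type) extends Arena V where
  F : Set V

def BuchiGame.toGame {V : Type} (Γ : BuchiGame V) : Game V where
  toArena := Γ.toArena
  win := {ρ | ∃ᶠ n in atTop, ρ n ∈ Γ.F}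

/-- The final vertices from which Player 0 can force infinitely many visits to `F`. -/
def BuchiGame.recur {V : Type} (Γ : BuchiGame V) : Set V :=
  {v | v ∈ Γ.F ∧ Γ.toGame.Wins v}

/-- The vertices from which Player 0 can force a visit to `T` within `n` moves. -/
def Arena.attr {V : Type} (G : Arena V) (T : Set V) : ℕ → Set V
  | 0 => T
  | n + 1 => G.attr T n ∪ {v | v ∈ G.V₀ ∧ ∃ u, G.E v u ∧ u ∈ G.attr T n} ∪
      {v | v ∉ G.V₀ ∧ ∀ u, G.E v u → u ∈ G.attr T n}

/-- Positional attractor strategies of a Büchi game: at a vertex of the attractor of `recur`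
outside `recur`, the distance to `recur` is decreased; from a vertex of `recur`, the play stays in
the attractor. -/
structure BuchiGame.IsAttractorStrategy {V : Type} (Γ : BuchiGame V) (g : V → V) : Prop where
  edge : ∀ v ∈ Γ.V₀, Γ.E v (g v)
  decrease : ∀ v ∈ Γ.V₀, ∀ n, v ∈ Γ.attr Γ.recur (n + 1) → v ∉ Γ.attr Γ.recur n →
    g v ∈ Γ.attr Γ.recur n
  stay : ∀ v ∈ Γ.V₀, v ∈ Γ.recur → ∃ n, g v ∈ Γ.attr Γ.recur n

/-! ### Request-response games and their simulation by Büchi games -/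

/-- A request-response game with `K` pairs `(P j, R j)`. -/
structure RRGame (V : Type) (K : ℕ) extends Arena V where
  P : Fin K → Set V
  R : Fin K → Set V

def RRGame.toGame {V : Type} {K : ℕ} (Γ : RRGame V K) : Game V where
  toArena := Γ.toArena
  win := {ρ | ∀ j, ∀ i, ρ i ∈ Γ.P j → ∃ i', i ≤ i' ∧ ρ i' ∈ Γ.R j}

/-- The memory contents of the simulating Büchi game: the set of the open requests, the marker and
the flag. The pairs are numbered from `0` to `K - 1` here, so that the marker values
`1, …, K` become `0, …, K - 1`. -/
abbrev RRMemory (K : ℕ) := Set (Fin K) × Fin K × Bool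

/-- The initial memory content `(∅, 1, 0)`. -/
def RRMemory.start (K : ℕ) [NeZero K] : RRMemory K := (∅, 0, false)

namespace RRGame

variable {V : Type} {K : ℕ}

/-- The set of open requests after leaving `v`. -/
def openRequests (Γ : RRGame V K) (s : RRMemory K) (v : V) : Set (Fin K) :=
  (s.1 ∪ {j | v ∈ Γ.P j}) \ {j | v ∈ Γ.R j}

open Classical in
/-- The marker after leaving `v`; the addition in `Fin K` is cyclic. -/
noncomputable def marker [NeZero K] (Γ : RRGame V K) (s : RRMemory K) (v : V) : Fin K :=
  if s.2.1 ∈ Γ.openRequests s v then s.2.1 else s.2.1 + 1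

open Classical in
/-- The memory content after leaving `v`; the flag is set when the marker passes from the last
value to the first one. -/
noncomputable def update [NeZero K] (Γ : RRGame V K) (s : RRMemory K) (v : V) : RRMemory K :=
  (Γ.openRequests s v, Γ.marker s v,
    decide ((s.2.1 : ℕ) + 1 = K ∧ Γ.marker s v = 0))

/-- The Büchi game that simulates a request-response game. -/
def buchi [NeZero K] (Γ : RRGame V K) : BuchiGame (RRMemory K × V) where
  V₀ := {p | p.2 ∈ Γ.V₀}
  E := fun p p' => p'.1 = Γ.update p.1 p.2 ∧ Γ.E p.2 p'.2
  F := {p | p.1.2.2 = true}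

/-- The strategy automaton for the request-response game with memory `RRMemory K` obtained from a
positional strategy in the simulating Büchi game. -/
noncomputable def strategyAutomaton [NeZero K] (Γ : RRGame V K)
    (g : RRMemory K × V → RRMemory K × V) : Mealy V (RRMemory K) where
  init := RRMemory.start K
  step := fun s v => Γ.update s v
  out := fun s v => (g (s, v)).2

end RRGame

/-! ### Automata, delayed simulation, direct bisimulation and the closure -/

/-- An automaton on infinite words over `A`, with an abstract acceptance condition on runs. -/
structure OmegaAutomaton (Q A : Type) where
  init : Q
  Δ : Q → A → Q → Prop
  acc : Set (ℕ → Q)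

structure BuchiAutomaton (Q A : Type) where
  init : Q
  Δ : Q → A → Q → Prop
  F : Set Q

/-- Simulation and bisimulation games on two copies of a transition relation `Δ`. A move of Spoiler
consists of the run that he extends (`false`: the first one, `true`: the second one), the letter and
the new state; Duplicator answers in the other run with the same letter. Histories list the moves of
Spoiler, the last one first, and a strategy `d` of Duplicator maps each nonempty history to the new
state of the run that she extends. -/
abbrev SpoilerMove (Q A : Type) := Bool × A × Q

section SimulationGame

variable {Q A : Type}

/-- The pair of current states after a history. -/
def positions (d : List (SpoilerMove Q A) → Q) (q q' : Q) : List (SpoilerMove Q A) → Q × Q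
  | [] => (q, q')
  | (false, a, p) :: h => (p, d ((false, a, p) :: h))
  | (true, a, p) :: h => (d ((true, a, p) :: h), p)

/-- The component of a pair that belongs to the given run. -/
def side (b : Bool) (p : Q × Q) : Q := if b then p.2 else p.1

/-- All moves of Spoiler in the history are legal; `sides` is the set of the runs that Spoiler is
allowed to extend. -/
def IsHistory (Δ : Q → A → Q → Prop) (sides : Set Bool) (d : List (SpoilerMove Q A) → Q)
    (q q' : Q) : List (SpoilerMove Q A) → Prop
  | [] => True
  | m :: h => IsHistory Δ sides d q q' h ∧ m.1 ∈ sides ∧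
      Δ (side m.1 (positions d q q' h)) m.2.1 m.2.2

/-- The history formed by the first `n` moves of a sequence. -/
def histOf (μ : ℕ → SpoilerMove Q A) : ℕ → List (SpoilerMove Q A)
  | 0 => []
  | n + 1 => μ n :: histOf μ n

/-- Duplicator has a winning strategy from `(q, q')`: she can answer every legal move, and the two
runs of every infinite play satisfy `W`. -/
def DuplicatorWins (Δ : Q → A → Q → Prop) (sides : Set Bool)
    (W : (ℕ → Q) → (ℕ → Q) → Prop) (q q' : Q) : Prop :=
  ∃ d : List (SpoilerMove Q A) → Q,
    (∀ m h, IsHistory Δ sides d q q' (m :: h) →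
      Δ (side (!m.1) (positions d q q' h)) m.2.1 (d (m :: h))) ∧
    ∀ μ : ℕ → SpoilerMove Q A, (∀ n, IsHistory Δ sides d q q' (histOf μ n)) →
      W (fun n => (positions d q q' (histOf μ n)).1) (fun n => (positions d q q' (histOf μ n)).2)

end SimulationGame

namespace BuchiAutomaton

variable {Q A : Type}

def toOmega (B : BuchiAutomaton Q A) : OmegaAutomaton Q A where
  init := B.init
  Δ := B.Δ
  acc := {ρ | ∃ᶠ n in atTop, ρ n ∈ B.F}

/-- `q'` delayed simulates `q`. -/
def DelayedSim (B : BuchiAutomaton Q A) (q q' : Q) : Prop :=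
  DuplicatorWins B.Δ {false} (fun ρ ρ' => ∀ i, ρ i ∈ B.F → ∃ j, i ≤ j ∧ ρ' j ∈ B.F) q q'

/-- `q` and `q'` delayed simulate each other. -/
def DelayedEquiv (B : BuchiAutomaton Q A) (q q' : Q) : Prop :=
  B.DelayedSim q q' ∧ B.DelayedSim q' q

/-- `q` and `q'` are direct bisimilar. -/
def DirectBisim (B : BuchiAutomaton Q A) (q q' : Q) : Prop :=
  DuplicatorWins B.Δ Set.univ (fun ρ ρ' => ∀ i, ρ i ∈ B.F ↔ ρ' i ∈ B.F) q q'

/-- The final states of the closure: the least set that contains `F` and every state all of whose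
successors it contains. -/
inductive InClosure (B : BuchiAutomaton Q A) : Q → Prop
  | base (q : Q) : q ∈ B.F → InClosure B q
  | step (q : Q) : (∀ a q', B.Δ q a q' → InClosure B q') → InClosure B q

def closure (B : BuchiAutomaton Q A) : BuchiAutomaton Q A where
  init := B.init
  Δ := B.Δ
  F := {q | B.InClosure q}

end BuchiAutomaton

/-! The relations above are equivalence relations: strategies of Duplicator can be copied, mirrored
and composed. -/

section Equivalences

variable {Q A : Type}

theorem DuplicatorWins.refl (Δ : Q → A → Q → Prop) (sides : Set Bool)
    {W : (ℕ → Q) → (ℕ → Q) → Prop} (hW : ∀ ρ, W ρ ρ) (q : Q) :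
    DuplicatorWins Δ sides W q q := by
  let d : List (SpoilerMove Q A) → Q := fun h => match h with
    | [] => q
    | m :: _ => m.2.2
  have key : ∀ h, (positions d q q h).2 = (positions d q q h).1 := by
    rintro (_ | ⟨⟨b, a, p⟩, h⟩)
    · rfl
    · cases b <;> rfl
  refine ⟨d, ?_, ?_⟩
  · rintro ⟨b, a, p⟩ h ⟨-, -, h3⟩
    have := key h
    cases b <;> simp_all [side, d]
  · intro μ _
    simp only [key]
    exact hW _

def SpoilerMove.swap (m : SpoilerMove Q A) : SpoilerMove Q A := (!m.1, m.2)

theorem DuplicatorWins.symm {Δ : Q → A → Q → Prop} {W : (ℕ → Q) → (ℕ → Q) → Prop}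
    (hW : ∀ ρ ρ', W ρ ρ' → W ρ' ρ) {q q' : Q} (H : DuplicatorWins Δ Set.univ W q q') :
    DuplicatorWins Δ Set.univ W q' q := by
  obtain ⟨d, h1, h2⟩ := H
  let d' : List (SpoilerMove Q A) → Q := fun h => d (h.map SpoilerMove.swap)
  have key : ∀ h, positions d' q' q h = (positions d q q' (h.map SpoilerMove.swap)).swap := by
    rintro (_ | ⟨⟨b, a, p⟩, h⟩)
    · rfl
    · cases b <;> rfl
  have key2 : ∀ h, IsHistory Δ Set.univ d' q' q h →
      IsHistory Δ Set.univ d q q' (h.map SpoilerMove.swap) := by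
    intro h
    induction h with
    | nil => exact id
    | cons m h ih =>
      rintro ⟨a1, -, a3⟩
      refine ⟨ih a1, trivial, ?_⟩
      rw [key] at a3
      obtain ⟨b, a, p⟩ := m
      cases b <;> simpa [SpoilerMove.swap, side] using a3
  refine ⟨d', ?_, ?_⟩
  · intro m h hm
    have := h1 _ _ (key2 _ hm)
    rw [key]
    obtain ⟨b, a, p⟩ := m
    cases b <;> simpa [SpoilerMove.swap, side, d'] using this
  · intro μ hμ
    have e : ∀ n, (histOf μ n).map SpoilerMove.swap = histOf (fun n => (μ n).swap) n := by
      intro n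
      induction n with
      | zero => rfl
      | succ n ih => simp [histOf, ih]
    have := h2 (fun n => (μ n).swap) (fun n => by rw [← e]; exact key2 _ (hμ n))
    simp only [key, e]
    exact hW _ _ this

/-- The histories of the two games that are played when two strategies are composed. -/
def composeHist (d₁ d₂ : List (SpoilerMove Q A) → Q) :
    List (SpoilerMove Q A) → List (SpoilerMove Q A) × List (SpoilerMove Q A)
  | [] => ([], [])
  | (false, a, p) :: h =>
    ((false, a, p) :: (composeHist d₁ d₂ h).1,
      (false, a, d₁ ((false, a, p) :: (composeHist d₁ d₂ h).1)) :: (composeHist d₁ d₂ h).2)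
  | (true, a, p) :: h =>
    ((true, a, d₂ ((true, a, p) :: (composeHist d₁ d₂ h).2)) :: (composeHist d₁ d₂ h).1,
      (true, a, p) :: (composeHist d₁ d₂ h).2)

theorem DuplicatorWins.trans {Δ : Q → A → Q → Prop} {sides : Set Bool}
    {W : (ℕ → Q) → (ℕ → Q) → Prop} (hW : ∀ ρ ρ' ρ'', W ρ ρ' → W ρ' ρ'' → W ρ ρ'')
    {q q' q'' : Q} (H₁ : DuplicatorWins Δ sides W q q') (H₂ : DuplicatorWins Δ sides W q' q'') :
    DuplicatorWins Δ sides W q q'' := by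
  obtain ⟨d₁, l₁, w₁⟩ := H₁
  obtain ⟨d₂, l₂, w₂⟩ := H₂
  let d : List (SpoilerMove Q A) → Q := fun h => match h with
    | [] => q
    | (false, a, p) :: t => d₂ (composeHist d₁ d₂ ((false, a, p) :: t)).2
    | (true, a, p) :: t => d₁ (composeHist d₁ d₂ ((true, a, p) :: t)).1
  have mid : ∀ h, (positions d₂ q' q'' (composeHist d₁ d₂ h).2).1 =
      (positions d₁ q q' (composeHist d₁ d₂ h).1).2 := by
    rintro (_ | ⟨⟨b, a, p⟩, h⟩)
    · rfl
    · cases b <;> rfl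
  have fst : ∀ h, (positions d q q'' h).1 = (positions d₁ q q' (composeHist d₁ d₂ h).1).1 := by
    rintro (_ | ⟨⟨b, a, p⟩, h⟩)
    · rfl
    · cases b <;> rfl
  have snd : ∀ h, (positions d q q'' h).2 = (positions d₂ q' q'' (composeHist d₁ d₂ h).2).2 := by
    rintro (_ | ⟨⟨b, a, p⟩, h⟩)
    · rfl
    · cases b <;> rfl
  have legal : ∀ h, IsHistory Δ sides d q q'' h →
      IsHistory Δ sides d₁ q q' (composeHist d₁ d₂ h).1 ∧
      IsHistory Δ sides d₂ q' q'' (composeHist d₁ d₂ h).2 := by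
    intro h
    induction h with
    | nil => exact fun _ => ⟨trivial, trivial⟩
    | cons m h ih =>
      rintro ⟨a1, a2, a3⟩
      obtain ⟨i1, i2⟩ := ih a1
      obtain ⟨b, a, p⟩ := m
      cases b
      · have k1 : IsHistory Δ sides d₁ q q' ((false, a, p) :: (composeHist d₁ d₂ h).1) :=
          ⟨i1, a2, by simpa [side, fst] using a3⟩
        refine ⟨k1, i2, a2, ?_⟩
        have := l₁ _ _ k1
        simpa [side, mid] using this
      · have k2 : IsHistory Δ sides d₂ q' q'' ((true, a, p) :: (composeHist d₁ d₂ h).2) :=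
          ⟨i2, a2, by simpa [side, snd] using a3⟩
        refine ⟨⟨i1, a2, ?_⟩, k2⟩
        have := l₂ _ _ k2
        simpa [side, mid] using this
  refine ⟨d, ?_, ?_⟩
  · intro m h hm
    obtain ⟨k1, k2⟩ := legal _ hm
    obtain ⟨b, a, p⟩ := m
    cases b
    · have := l₂ _ _ k2
      change Δ (positions d q q'' h).2 a _
      rw [snd]
      exact this
    · have := l₁ _ _ k1
      change Δ (positions d q q'' h).1 a _
      rw [fst]
      exact this
  · intro μ hμ
    have ex : ∃ μ₁ μ₂ : ℕ → SpoilerMove Q A, ∀ n,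
        composeHist d₁ d₂ (histOf μ n) = (histOf μ₁ n, histOf μ₂ n) := by
      refine ⟨fun n => ((composeHist d₁ d₂ (histOf μ (n + 1))).1).headD (μ n),
        fun n => ((composeHist d₁ d₂ (histOf μ (n + 1))).2).headD (μ n), ?_⟩
      intro n
      induction n with
      | zero => rfl
      | succ n ih =>
        simp only [histOf] at ih ⊢
        rcases μ n with ⟨b, a, p⟩
        cases b <;> simp [composeHist, ih]
    obtain ⟨μ₁, μ₂, e⟩ := ex
    have r₁ := w₁ μ₁ (fun n => by have := (legal _ (hμ n)).1; rwa [e] at this)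
    have r₂ := w₂ μ₂ (fun n => by have := (legal _ (hμ n)).2; rwa [e] at this)
    have mid' : ∀ n, (positions d₂ q' q'' (histOf μ₂ n)).1 =
        (positions d₁ q q' (histOf μ₁ n)).2 := fun n => by
      have := mid (histOf μ n); rwa [e] at this
    simp only [mid'] at r₂
    simp only [fst, snd, e]
    exact hW _ _ _ r₁ r₂

namespace BuchiAutomaton

theorem delayedSim_refl (B : BuchiAutomaton Q A) (q : Q) : B.DelayedSim q q :=
  DuplicatorWins.refl _ _ (fun _ i hi => ⟨i, le_rfl, hi⟩) q

theorem delayedSim_trans (B : BuchiAutomaton Q A) {q q' q'' : Q} (h : B.DelayedSim q q')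
    (h' : B.DelayedSim q' q'') : B.DelayedSim q q'' := by
  refine DuplicatorWins.trans ?_ h h'
  intro ρ ρ' ρ'' h1 h2 i hi
  obtain ⟨j, hj, hj'⟩ := h1 i hi
  obtain ⟨l, hl, hl'⟩ := h2 j hj'
  exact ⟨l, hj.trans hl, hl'⟩

/-- The equivalence relation of mutual delayed simulation. -/
def delayedSetoid (B : BuchiAutomaton Q A) : Setoid Q where
  r := B.DelayedEquiv
  iseqv :=
    { refl := fun q => ⟨B.delayedSim_refl q, B.delayedSim_refl q⟩
      symm := fun h => ⟨h.2, h.1⟩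
      trans := fun h h' => ⟨B.delayedSim_trans h.1 h'.1, B.delayedSim_trans h'.2 h.2⟩ }

/-- The equivalence relation of direct bisimilarity. -/
def directSetoid (B : BuchiAutomaton Q A) : Setoid Q where
  r := B.DirectBisim
  iseqv :=
    { refl := fun q => DuplicatorWins.refl _ _ (fun _ _ => Iff.rfl) q
      symm := fun h => DuplicatorWins.symm (fun _ _ h i => (h i).symm) h
      trans := fun h h' =>
        DuplicatorWins.trans (fun _ _ _ h h' i => (h i).trans (h' i)) h h' }

/-- The restriction of an automaton to a set of states that contains the initial state. -/
def restrict (B : BuchiAutomaton Q A) (X : Set Q) (hX : B.init ∈ X) : BuchiAutomaton X A where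
  init := ⟨B.init, hX⟩
  Δ := fun q a q' => B.Δ q a q'
  F := {q | (q : Q) ∈ B.F}

end BuchiAutomaton

end Equivalences

/-! ### Game automata, their quotients and the memory reduction -/

/-- The states of a game automaton: a fresh initial state, the pairs of a memory content and a
vertex, and a sink. -/
inductive GAState (S V : Type)
  | init : GAState S V
  | mem (s : S) (v : V) : GAState S V
  | sink : GAState S V

/-- The vertex component of a state. -/
def GAState.vertex? {S V : Type} : GAState S V → Option V
  | .init => none
  | .mem _ v => some v
  | .sink => none

section Reduction

variable {S V : Type}

/-- The transitions of the game automaton of a game over `S × V` that simulates a game on the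
arena `G`. -/
inductive gaStep (G : Arena V) (s₀ : S) (G' : Arena (S × V)) :
    GAState S V → V → GAState S V → Prop
  | init (v' : V) : gaStep G s₀ G' .init v' (.mem s₀ v')
  | edge (s : S) (v : V) (s' : S) (v' : V) :
      G'.E (s, v) (s', v') → gaStep G s₀ G' (.mem s v) v' (.mem s' v')
  | noEdge (s : S) (v v' : V) : ¬ G.E v v' → gaStep G s₀ G' (.mem s v) v' .sink
  | sink (v' : V) : gaStep G s₀ G' .sink v' .sink

/-- The game automaton of a simulating Büchi game. -/
def gameAutomaton (G : Arena V) (s₀ : S) (Γ' : BuchiGame (S × V)) :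
    BuchiAutomaton (GAState S V) V where
  init := .init
  Δ := gaStep G s₀ Γ'.toArena
  F := {q | ∃ s v, q = .mem s v ∧ (s, v) ∈ Γ'.F}

/-- The states of a game automaton other than the sink. -/
abbrev LiveState (S V : Type) := {q : GAState S V | q ≠ .sink}

def LiveState.mem (s : S) (v : V) : LiveState S V := ⟨.mem s v, by simp⟩

/-- The game automaton without its sink. Its inputs are the plays of the game, and on them the sink
is never entered. The delayed simulation and the closure refer to this automaton. -/
def liveAutomaton (G : Arena V) (s₀ : S) (Γ' : BuchiGame (S × V)) :
    BuchiAutomaton (LiveState S V) V :=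
  (gameAutomaton G s₀ Γ').restrict {q | q ≠ .sink} (by simp [gameAutomaton])

/-- The restriction to `S × V` of an equivalence relation on the states. -/
def onPairs (r : Setoid (LiveState S V)) : Setoid (S × V) :=
  r.comap fun p => LiveState.mem p.1 p.2

/-- The equivalence relation on the memory contents derived from an equivalence relation on
`S × V`. -/
def memSetoid (r : Setoid (S × V)) : Setoid S where
  r := fun s₁ s₂ => ∀ v, r (s₁, v) (s₂, v)
  iseqv :=
    { refl := fun _ _ => r.refl _
      symm := fun h v => r.symm (h v)
      trans := fun h h' v => r.trans (h v) (h' v) }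

/-- `s` is the least element of `X` with respect to the strict order `prec`. -/
def IsLeastFor (prec : S → S → Prop) (X : Set S) (s : S) : Prop :=
  s ∈ X ∧ ∀ t ∈ X, s = t ∨ prec s t

/-- The transitions of the quotient automaton; the target is determined by the least memory content
that is reached from some element of the class. -/
inductive quotientStep (G : Arena V) (Δ : GAState S V → V → GAState S V → Prop) (e : Setoid S)
    (prec : S → S → Prop) : GAState (Quotient e) V → V → GAState (Quotient e) V → Prop
  | init (v' : V) (s' : S) : IsLeastFor prec {t | Δ .init v' (.mem t v')} s' →
      quotientStep G Δ e prec .init v' (.mem (Quotient.mk e s') v')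
  | edge (c : Quotient e) (v v' : V) (s' : S) : G.E v v' →
      IsLeastFor prec {t | ∃ s, Quotient.mk e s = c ∧ Δ (.mem s v) v' (.mem t v')} s' →
      quotientStep G Δ e prec (.mem c v) v' (.mem (Quotient.mk e s') v')
  | noEdge (c : Quotient e) (v v' : V) : ¬ G.E v v' →
      quotientStep G Δ e prec (.mem c v) v' .sink
  | sink (v' : V) : quotientStep G Δ e prec .sink v' .sink

/-- The quotient of a game automaton by an equivalence relation on the memory contents. A run is
accepting if the run of the given automaton through the same vertices is. -/
def quotientAutomaton (G : Arena V) (B : BuchiAutomaton (GAState S V) V) (e : Setoid S)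
    (prec : S → S → Prop) : OmegaAutomaton (GAState (Quotient e) V) V where
  init := .init
  Δ := quotientStep G B.Δ e prec
  acc := {ρ | ∃ ρ' : ℕ → GAState S V, ρ' 0 = .init ∧ (∀ n, ∃ a, B.Δ (ρ' n) a (ρ' (n + 1))) ∧
    (∀ n, (ρ' n).vertex? = (ρ n).vertex?) ∧ ρ' ∈ B.toOmega.acc}

/-- A game whose vertices are pairs of a memory content and a vertex. -/
structure MemoryGame (V : Type) where
  Mem : Type
  start : Mem
  game : Game (Mem × V)

/-- The automaton game: the game graph consists of the pairs of a memory content and a vertex, and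
a play is won by Player 0 if, preceded by the initial state, it is an accepting run. -/
def automatonGame (G : Arena V) (start : S) (B : OmegaAutomaton (GAState S V) V) :
    MemoryGame V where
  Mem := S
  start := start
  game :=
    { V₀ := {p | p.2 ∈ G.V₀}
      E := fun p p' => B.Δ (.mem p.1 p.2) p'.2 (.mem p'.1 p'.2)
      win := {ρ | (fun n => match n with
        | 0 => GAState.init
        | n + 1 => GAState.mem (ρ n).1 (ρ n).2) ∈ B.acc} }

end Reduction

namespace RRGame

variable {V : Type} {K : ℕ} [NeZero K]

/-- The game automaton (without its sink) of the Büchi game that simulates `Γ`. -/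
noncomputable def automaton (Γ : RRGame V K) : BuchiAutomaton (LiveState (RRMemory K) V) V :=
  liveAutomaton Γ.toArena (RRMemory.start K) Γ.buchi

/-- The result of the memory reduction for a given equivalence relation on the pairs of a memory
content and a vertex: the automaton game of the quotient of the game automaton. -/
noncomputable def reducedGame (Γ : RRGame V K) (r : Setoid (RRMemory K × V))
    (prec : RRMemory K → RRMemory K → Prop) : MemoryGame V :=
  automatonGame Γ.toArena (Quotient.mk (memSetoid r) (RRMemory.start K))
    (quotientAutomaton Γ.toArena (gameAutomaton Γ.toArena (RRMemory.start K) Γ.buchi)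
      (memSetoid r) prec)

/-- The memory reduction algorithm: the equivalence relation is the direct bisimilarity in the
closure of the game automaton. -/
noncomputable def memoryReduction (Γ : RRGame V K) (prec : RRMemory K → RRMemory K → Prop) :
    MemoryGame V :=
  Γ.reducedGame (onPairs Γ.automaton.closure.directSetoid) prec

/-- The memory reduction with the equivalence relation of mutual delayed simulation in the game
automaton. -/
noncomputable def delayedReduction (Γ : RRGame V K) (prec : RRMemory K → RRMemory K → Prop) :
    MemoryGame V :=
  Γ.reducedGame (onPairs Γ.automaton.delayedSetoid) prec

end RRGame

/-! ### The game graphs `G_k` -/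

/-- The vertices of `G_k`, where indices are counted from `0` and `k` is positive: `a 0` is the
vertex `v`, and `w 0` is the vertex `w`. -/
inductive Vertex (k : ℕ)
  | a (i : Fin k) : Vertex k
  | p (i : Fin k) : Vertex k
  | p' (i : Fin k) : Vertex k
  | w (i : Fin k) : Vertex k
  | r (i : Fin k) : Vertex k
  | r' (i : Fin k) : Vertex k
  | x : Vertex k
  | y : Vertex k

/-- The edges of `G_k`. -/
inductive Edge {k : ℕ} : Vertex k → Vertex k → Prop
  | request (i : Fin k) : Edge (.a i) (.p i)
  | request' (i : Fin k) : Edge (.a i) (.p' i)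
  | next (i j : Fin k) : (j : ℕ) = i + 1 → Edge (.p i) (.a j)
  | next' (i j : Fin k) : (j : ℕ) = i + 1 → Edge (.p' i) (.a j)
  | switch (i j : Fin k) : (i : ℕ) + 1 = k → (j : ℕ) = 0 → Edge (.p i) (.w j)
  | switch' (i j : Fin k) : (i : ℕ) + 1 = k → (j : ℕ) = 0 → Edge (.p' i) (.w j)
  | response (i : Fin k) : Edge (.w i) (.r i)
  | response' (i : Fin k) : Edge (.w i) (.r' i)
  | onward (i j : Fin k) : (j : ℕ) = i + 1 → Edge (.r i) (.w j)
  | onward' (i j : Fin k) : (j : ℕ) = i + 1 → Edge (.r' i) (.w j)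
  | finish (i : Fin k) : (i : ℕ) + 1 = k → Edge (.r i) .x
  | finish' (i : Fin k) : (i : ℕ) + 1 = k → Edge (.r' i) .x
  | last : Edge .x .y
  | loop : Edge .y .y

/-- The request-response game `Γ_k`. The pairs are listed in the order
`(P_0, R_0), (P_1, R_1), (P'_1, R'_1), …, (P_k, R_k), (P'_k, R'_k)`. -/
def gammaGame (k : ℕ) : RRGame (Vertex k) (2 * k + 1) where
  V₀ := {u | ∃ i, u = .w i}
  E := Edge
  P := fun j => {u | (∃ i : Fin k, u = .a i ∧ (i : ℕ) = 0 ∧ (j : ℕ) = 0) ∨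
    (∃ i : Fin k, u = .p i ∧ (j : ℕ) = 2 * i + 1) ∨
    (∃ i : Fin k, u = .p' i ∧ (j : ℕ) = 2 * i + 2)}
  R := fun j => {u | u = .y ∨ (∃ i : Fin k, u = .w i ∧ (i : ℕ) = 0 ∧ (j : ℕ) = 0) ∨
    (∃ i : Fin k, u = .r i ∧ (j : ℕ) = 2 * i + 1) ∨
    (∃ i : Fin k, u = .r' i ∧ (j : ℕ) = 2 * i + 2)}

/-! ### Generalities on attractors -/

/-! The graph is layered: `rank` drops by exactly one along each edge until `y`, so every play ends
in the loop at `y`, which answers all requests. In the Büchi game no request is open after `y`, so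
the marker advances at each further move and wraps around again and again (`potential_decreases`,
`frequently_final`). Hence every play of either game is won, `recur` is the set of all final
vertices, and the whole graph is its attractor. For the same reason the memory is redundant for the
reduction: every state lies in the closure, and any two runs through the same vertices satisfy both
simulation conditions when Duplicator copies the letters (`duplicatorWins_of_isPath`).

Attractor strategies are nevertheless forced to remember. Player 1 encodes `b : Fin k → Bool` by
choosing `p i` or `p' i`, while the request of pair 0 holds the marker at 0. From `w 0` there are `2
* k + 1` moves to `y`, exactly as many as the marker needs to wrap. If each `w i` answers the
request that was made, the marker is never blocked and the flag is set on arrival at `y`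
(`Tracks.update`, `Tracks.mem_attr`). The marker cannot be faster (`notMem_attr_of_marker`), and a
wrong answer leaves a request that blocks it until `y` (`notMem_attr_of_pending`). So decreasing the
distance means reproducing `b` (`attractorStrategy_w`), and an automaton doing this has distinct
states at `w 0` for the `2 ^ k` functions `b` (`two_pow_le_card`). -/

theorem Arena.attr_mono {V : Type} (G : Arena V) (T : Set V) : Monotone (G.attr T) :=
  monotone_nat_of_le_succ fun _ _ hv => Or.inl (Or.inl hv)

/-- A potential that decreases along every edge, unless the edge leads to `T`, bounds the attractor
distance to `T`. -/
theorem Arena.mem_attr_of_potential {V : Type} (G : Arena V) (T : Set V) (Φ : V → ℕ)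
    (hser : ∀ v, ∃ u, G.E v u) (hΦ : ∀ v u, G.E v u → Φ u < Φ v ∨ u ∈ T) (n : ℕ) :
    ∀ v, Φ v < n → v ∈ G.attr T n := by
  induction n with
  | zero => exact fun v hv => absurd hv (Nat.not_lt_zero _)
  | succ n ih =>
    intro v hv
    have key : ∀ u, G.E v u → u ∈ G.attr T n := by
      intro u hu
      rcases hΦ v u hu with h | h
      · exact ih u (by omega)
      · exact G.attr_mono T (Nat.zero_le n) h
    by_cases h0 : v ∈ G.V₀
    · obtain ⟨u, hu⟩ := hser v
      exact Or.inl (Or.inr ⟨h0, u, hu, key u hu⟩)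
    · exact Or.inr ⟨h0, key⟩

/-- If `U n` avoids `T` and every edge from `U (n + 1)` leads to `U n`, then `T` is not reached from
`U n` within `n` moves. -/
theorem Arena.notMem_attr {V : Type} (G : Arena V) (T : Set V) (U : ℕ → Set V)
    (hser : ∀ v, ∃ u, G.E v u) (hT : ∀ n, ∀ v ∈ U n, v ∉ T) (hU : Antitone U)
    (hE : ∀ n, ∀ v ∈ U (n + 1), ∀ u, G.E v u → u ∈ U n) (n : ℕ) :
    ∀ v ∈ U n, v ∉ G.attr T n := by
  induction n with
  | zero => exact hT 0
  | succ n ih =>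
    rintro v hv ((h | ⟨-, u, hu, h⟩) | ⟨-, h⟩)
    · exact ih v (hU n.le_succ hv) h
    · exact ih u (hE n v hv u hu) h
    · obtain ⟨u, hu⟩ := hser v
      exact ih u (hE n v hv u hu) (h u hu)

/-- Positional attractor strategies exist if every vertex is in the attractor. -/
theorem BuchiGame.exists_isAttractorStrategy {V : Type} (Γ : BuchiGame V)
    (hser : ∀ v, ∃ u, Γ.E v u) (hattr : ∀ v, ∃ n, v ∈ Γ.attr Γ.recur n) :
    ∃ g, Γ.IsAttractorStrategy g := by
  have H : ∀ v, ∃ u, v ∈ Γ.V₀ → Γ.E v u ∧ ∀ n, v ∈ Γ.attr Γ.recur (n + 1) →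
      v ∉ Γ.attr Γ.recur n → u ∈ Γ.attr Γ.recur n := by
    intro v
    -- By monotonicity there is at most one level at which `v` enters the attractor, so a single
    -- choice of `u` serves all `n`. Without such a level the condition on `u` is vacuous.
    by_cases hn : ∃ n, v ∈ Γ.attr Γ.recur (n + 1) ∧ v ∉ Γ.attr Γ.recur n
    · obtain ⟨n, h1, h2⟩ := hn
      rcases h1 with (h | ⟨-, u, hu, h⟩) | ⟨h, -⟩
      · exact absurd h h2
      · refine ⟨u, fun _ => ⟨hu, fun m hm _ => ?_⟩⟩
        rcases le_or_gt n m with hnm | hnm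
        · exact Γ.attr_mono _ hnm h
        · exact absurd (Γ.attr_mono _ hnm hm) h2
      · exact ⟨v, fun h0 => absurd h0 h⟩
    · obtain ⟨u, hu⟩ := hser v
      exact ⟨u, fun _ => ⟨hu, fun n h1 h2 => absurd ⟨n, h1, h2⟩ hn⟩⟩
  choose g hg using H
  exact ⟨g, fun v hv => (hg v hv).1, fun v hv => (hg v hv).2, fun v _ _ => hattr (g v)⟩

theorem past_succ {V : Type} (ρ : ℕ → V) (n : ℕ) : past ρ (n + 1) = past ρ n ++ [ρ n] := by
  simp [past, List.range_succ]

/-! ### The plays of `Γ_k` reach `y` -/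

namespace Vertex

variable {k : ℕ}

/-- The number of moves before the vertex `y` is reached. -/
def rank : Vertex k → ℕ
  | a i => 4 * k + 1 - 2 * i
  | p i => 4 * k - 2 * i
  | p' i => 4 * k - 2 * i
  | w i => 2 * k + 1 - 2 * i
  | r i => 2 * k - 2 * i
  | r' i => 2 * k - 2 * i
  | x => 1
  | y => 0

/-- Both choices at `a i` or `w i` lead to paths of equal length. The exact decrement, and not just
a decrease, is what allows a comparison of the distance to `y` with the position of the marker. -/
theorem rank_add_one {u u' : Vertex k} (h : Edge u u') (hu : u ≠ y) : u'.rank + 1 = u.rank := by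
  cases h <;> simp [rank] at hu ⊢ <;> omega

theorem eq_y_of_edge {u : Vertex k} (h : Edge y u) : u = y := by
  cases h; rfl

variable [NeZero k]

/-- The successor on the play in which the pending requests are described by `b`, and each of them
is answered. -/
def next (b : Fin k → Bool) : Vertex k → Vertex k
  | a i => if b i then p i else p' i
  | p i => if h : (i : ℕ) + 1 < k then a ⟨i + 1, h⟩ else w 0
  | p' i => if h : (i : ℕ) + 1 < k then a ⟨i + 1, h⟩ else w 0
  | w i => if b i then r i else r' i
  | r i => if h : (i : ℕ) + 1 < k then w ⟨i + 1, h⟩ else x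
  | r' i => if h : (i : ℕ) + 1 < k then w ⟨i + 1, h⟩ else x
  | x => y
  | y => y

theorem edge_next (b : Fin k → Bool) (u : Vertex k) : Edge u (u.next b) := by
  cases u with
  | a i => by_cases h : b i <;> simp [next, h] <;> constructor
  | w i => by_cases h : b i <;> simp [next, h] <;> constructor
  | p i =>
    by_cases h : (i : ℕ) + 1 < k <;> simp only [next, h, dite_true, dite_false]
    · exact Edge.next _ _ rfl
    · exact Edge.switch _ _ (by omega) (by simp)
  | p' i =>
    by_cases h : (i : ℕ) + 1 < k <;> simp only [next, h, dite_true, dite_false]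
    · exact Edge.next' _ _ rfl
    · exact Edge.switch' _ _ (by omega) (by simp)
  | r i =>
    by_cases h : (i : ℕ) + 1 < k <;> simp only [next, h, dite_true, dite_false]
    · exact Edge.onward _ _ rfl
    · exact Edge.finish _ (by omega)
  | r' i =>
    by_cases h : (i : ℕ) + 1 < k <;> simp only [next, h, dite_true, dite_false]
    · exact Edge.onward' _ _ rfl
    · exact Edge.finish' _ (by omega)
  | x => exact Edge.last
  | y => exact Edge.loop

/-- In the second half of the graph, only the vertices `w i` have more than one successor. -/
theorem eq_next_of_edge (b : Fin k → Bool) {u u' : Vertex k} (h : Edge u u')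
    (hu : u.rank ≤ 2 * k + 1) (hw : ∀ i, u ≠ w i) : u' = u.next b := by
  cases h with
  | request i => simp only [rank] at hu; omega
  | request' i => simp only [rank] at hu; omega
  | next i j => simp only [rank] at hu; omega
  | next' i j => simp only [rank] at hu; omega
  | switch i j => simp only [rank] at hu; omega
  | switch' i j => simp only [rank] at hu; omega
  | response i => exact absurd rfl (hw i)
  | response' i => exact absurd rfl (hw i)
  | onward i j hj =>
    have : (i : ℕ) + 1 < k := by omega
    simp only [Vertex.next, this, dite_true]
    exact congrArg w (Fin.ext hj)
  | onward' i j hj =>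
    have : (i : ℕ) + 1 < k := by omega
    simp only [Vertex.next, this, dite_true]
    exact congrArg w (Fin.ext hj)
  | finish i hi =>
    have : ¬ (i : ℕ) + 1 < k := by omega
    simp only [Vertex.next, this, dite_false]
  | finish' i hi =>
    have : ¬ (i : ℕ) + 1 < k := by omega
    simp only [Vertex.next, this, dite_false]
  | last => rfl
  | loop => rfl

end Vertex

theorem exists_eq_y {k : ℕ} {ρ : ℕ → Vertex k} (hρ : ∀ n, Edge (ρ n) (ρ (n + 1))) (n : ℕ) :
    ∃ m, n ≤ m ∧ ρ m = .y := by
  induction h : (ρ n).rank using Nat.strong_induction_on generalizing n with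
  | _ d ih =>
    by_cases hy : ρ n = .y
    · exact ⟨n, le_rfl, hy⟩
    · have := Vertex.rank_add_one (hρ n) hy
      obtain ⟨m, hm, e⟩ := ih _ (by omega) (n + 1) rfl
      exact ⟨m, by omega, e⟩

/-! ### Every play of both games is won -/

section GammaGame

variable {k : ℕ}

theorem y_mem_R (j : Fin (2 * k + 1)) : Vertex.y ∈ (gammaGame k).R j := Or.inl rfl

theorem mem_win_of_isPath {ρ : ℕ → Vertex k} (hρ : (gammaGame k).IsPath ρ) :
    ρ ∈ (gammaGame k).toGame.win := by
  intro j i _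
  obtain ⟨m, hm, e⟩ := exists_eq_y hρ i
  exact ⟨m, hm, e ▸ y_mem_R j⟩

theorem isWinningFrom_of_isStrategy {f : Strategy (Vertex k)}
    (hf : (gammaGame k).IsStrategy f) (v : Vertex k) : (gammaGame k).toGame.IsWinningFrom f v :=
  ⟨hf, fun _ hρ _ _ => mem_win_of_isPath hρ⟩

theorem openRequests_y (s : RRMemory (2 * k + 1)) : (gammaGame k).openRequests s .y = ∅ := by
  ext j
  simp only [RRGame.openRequests, Set.mem_sdiff, Set.mem_ofPred_eq, Set.mem_empty_iff_false, iff_false]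
  exact fun h => h.2 (y_mem_R j)

/-- A bound for the number of moves before `(∅, 0, true, y)` is visited. -/
def potential (q : RRMemory (2 * k + 1) × Vertex k) : ℕ :=
  if q.2.rank = 0 then 2 * k + 1 - q.1.2.1 else 2 * k + 1 + q.2.rank

/-- At `y` nothing is open, so the marker advances; when it leaves its last value, the flag is set
and the target is the exceptional vertex. Elsewhere the rank drops, and the offset `2 * k + 1`
dominates all values of the potential at `y`. -/
theorem potential_decreases {q q' : RRMemory (2 * k + 1) × Vertex k}
    (h : (gammaGame k).buchi.E q q') :
    potential q' < potential q ∨ q' = ((∅, 0, true), .y) := by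
  obtain ⟨s, u⟩ := q
  obtain ⟨s', u'⟩ := q'
  obtain ⟨h1, h2⟩ := h
  change s' = _ at h1
  change Edge u u' at h2
  by_cases hu : u = .y
  · subst hu
    obtain rfl := Vertex.eq_y_of_edge h2
    have hm : (gammaGame k).marker s .y = s.2.1 + 1 := by
      simp [RRGame.marker, openRequests_y]
    by_cases hK : (s.2.1 : ℕ) + 1 = 2 * k + 1
    · right
      have h0 : s.2.1 + 1 = 0 := by
        have : s.2.1 = Fin.last (2 * k) := Fin.ext (by simpa using hK)
        rw [this, Fin.last_add_one]
      rw [h1, RRGame.update, hm, openRequests_y, h0]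
      simp [hK]
    · left
      have h0 : ((s.2.1 + 1 : Fin (2 * k + 1)) : ℕ) = s.2.1 + 1 :=
        Fin.val_add_one_of_lt' (by omega)
      subst h1
      simp only [potential, Vertex.rank, if_true, RRGame.update, hm, h0]
      omega
  · left
    have := Vertex.rank_add_one h2 hu
    simp only [potential]
    split_ifs <;> omega

theorem frequently_final {ρ : ℕ → RRMemory (2 * k + 1) × Vertex k}
    (hρ : (gammaGame k).buchi.IsPath ρ) :
    ∃ᶠ n in atTop, ρ n = ((∅, 0, true), .y) := by
  rw [frequently_atTop]
  intro n
  induction h : potential (ρ n) using Nat.strong_induction_on generalizing n with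
  | _ d ih =>
    rcases potential_decreases (hρ n) with h' | h'
    · obtain ⟨m, hm, e⟩ := ih _ (h ▸ h') (n + 1) rfl
      exact ⟨m, by omega, e⟩
    · exact ⟨n + 1, by omega, h'⟩

theorem mem_buchi_win_of_isPath {ρ : ℕ → RRMemory (2 * k + 1) × Vertex k}
    (hρ : (gammaGame k).buchi.IsPath ρ) : ρ ∈ (gammaGame k).buchi.toGame.win :=
  (frequently_final hρ).mono fun n hn => by rw [hn]; rfl

/-- Both winning conditions hold on every path, so the winners agree without any comparison of the
marker with the requests. -/
theorem simulates_gammaGame :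
    Simulates (gammaGame k).toGame (RRMemory.start (2 * k + 1)) (gammaGame k).buchi.toGame where
  owner _ _ := Iff.rfl
  exists_update s v _ h := ⟨(gammaGame k).update s v, rfl, h⟩
  unique_update _ _ _ _ _ _ h₁ h₂ := h₁.1.trans h₂.1.symm
  edge _ _ _ _ h := h.2
  win_iff _ _ h h' _ _ := iff_of_true (mem_win_of_isPath h) (mem_buchi_win_of_isPath h')

theorem buchi_isWinningFrom {g : RRMemory (2 * k + 1) × Vertex k → RRMemory (2 * k + 1) × Vertex k}
    (hg : ∀ v ∈ (gammaGame k).buchi.V₀, (gammaGame k).buchi.E v (g v)) (v) :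
    (gammaGame k).buchi.toGame.IsWinningFrom (positional g) v :=
  ⟨fun _ v hv _ => hg v hv, fun _ hρ _ _ => mem_buchi_win_of_isPath hρ⟩

theorem strategyAutomaton_isWinningFrom
    {g : RRMemory (2 * k + 1) × Vertex k → RRMemory (2 * k + 1) × Vertex k}
    (hg : ∀ v ∈ (gammaGame k).buchi.V₀, (gammaGame k).buchi.E v (g v)) (v) :
    (gammaGame k).toGame.IsWinningFrom ((gammaGame k).strategyAutomaton g).toStrategy v :=
  isWinningFrom_of_isStrategy (fun _ _ hv _ => (hg (_, _) hv).2) v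

variable [NeZero k]

theorem exists_buchi_edge (q : RRMemory (2 * k + 1) × Vertex k) :
    ∃ q', (gammaGame k).buchi.E q q' :=
  ⟨(_, q.2.next fun _ => true), rfl, Vertex.edge_next _ _⟩

/-- Any choice of edges wins from everywhere, so every final vertex is recurrent and attractor
distances are distances to `F`. -/
theorem recur_gammaGame : (gammaGame k).buchi.recur = (gammaGame k).buchi.F := by
  choose g hg using exists_buchi_edge (k := k)
  ext v
  exact ⟨fun h => h.1, fun h => ⟨h, _, buchi_isWinningFrom (fun v _ => hg v) v⟩⟩

theorem exists_isAttractorStrategy_gammaGame :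
    ∃ g, (gammaGame k).buchi.IsAttractorStrategy g := by
  refine BuchiGame.exists_isAttractorStrategy _ exists_buchi_edge fun v => ?_
  rw [recur_gammaGame]
  refine ⟨potential v + 1, Arena.mem_attr_of_potential _ _ potential exists_buchi_edge
    (fun v u h => ?_) _ v (Nat.lt_succ_self _)⟩
  rcases potential_decreases h with h | rfl
  · exact Or.inl h
  · exact Or.inr rfl

/-! ### Attractor strategies answer the pending requests -/

/-- The number of the pair `(P_i, R_i)`. -/
def reqIdx (l : Fin k) : Fin (2 * k + 1) := ⟨2 * l + 1, by omega⟩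

/-- The number of the pair `(P'_i, R'_i)`. -/
def reqIdx' (l : Fin k) : Fin (2 * k + 1) := ⟨2 * l + 2, by omega⟩

theorem zero_mem_openRequests (s : RRMemory (2 * k + 1)) (u : Vertex k) :
    0 ∈ (gammaGame k).openRequests s u ↔ (0 ∈ s.1 ∨ u = .a 0) ∧ u ≠ .y ∧ u ≠ .w 0 := by
  cases u <;> simp [RRGame.openRequests, gammaGame]

theorem reqIdx_mem_openRequests (s : RRMemory (2 * k + 1)) (u : Vertex k) (l : Fin k) :
    reqIdx l ∈ (gammaGame k).openRequests s u ↔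
      (reqIdx l ∈ s.1 ∨ u = .p l) ∧ u ≠ .y ∧ u ≠ .r l := by
  cases u <;> simp [RRGame.openRequests, gammaGame, reqIdx] <;> grind

theorem reqIdx'_mem_openRequests (s : RRMemory (2 * k + 1)) (u : Vertex k) (l : Fin k) :
    reqIdx' l ∈ (gammaGame k).openRequests s u ↔
      (reqIdx' l ∈ s.1 ∨ u = .p' l) ∧ u ≠ .y ∧ u ≠ .r' l := by
  cases u <;> simp [RRGame.openRequests, gammaGame, reqIdx'] <;> grind

end GammaGame

/-! ### Memory contents along the plays that answer every request -/

section Tracking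

variable {k : ℕ}

/-- The open requests: the first one if `Z`, and those chosen by `b` for the indices in `L`. -/
structure Pending (b : Fin k → Bool) (X : Set (Fin (2 * k + 1))) (Z : Prop) (L : Fin k → Prop) :
    Prop where
  zero : 0 ∈ X ↔ Z
  req : ∀ l, reqIdx l ∈ X ↔ L l ∧ b l = true
  req' : ∀ l, reqIdx' l ∈ X ↔ L l ∧ b l = false

theorem marker_of_mem {s : RRMemory (2 * k + 1)} {u : Vertex k}
    (h : s.2.1 ∈ (gammaGame k).openRequests s u) : (gammaGame k).marker s u = s.2.1 := by
  simp [RRGame.marker, h]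

theorem marker_of_notMem {s : RRMemory (2 * k + 1)} {u : Vertex k}
    (h : s.2.1 ∉ (gammaGame k).openRequests s u) : (gammaGame k).marker s u = s.2.1 + 1 := by
  simp [RRGame.marker, h]

/-- The inequality also covers the wrap to 0. It limits the speed of the marker in both lower bounds
for the attractor distance. -/
theorem val_marker_le (s : RRMemory (2 * k + 1)) (u : Vertex k) :
    ((gammaGame k).marker s u : ℕ) ≤ s.2.1 + 1 := by
  by_cases h : s.2.1 ∈ (gammaGame k).openRequests s u
  · rw [marker_of_mem h]; omega
  · rw [marker_of_notMem h, Fin.val_add_one]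
    split_ifs <;> omega

theorem flag_update_of_lt {s : RRMemory (2 * k + 1)} (u : Vertex k) (h : (s.2.1 : ℕ) < 2 * k) :
    ((gammaGame k).update s u).2.2 = false := by
  simp only [RRGame.update, decide_eq_false_iff_not]
  omega

theorem val_marker_of_notMem {s : RRMemory (2 * k + 1)} {u : Vertex k} (hs : (s.2.1 : ℕ) < 2 * k)
    (h : s.2.1 ∉ (gammaGame k).openRequests s u) :
    ((gammaGame k).marker s u : ℕ) = s.2.1 + 1 := by
  rw [marker_of_notMem h, Fin.val_add_one_of_lt' (by omega)]

theorem lt_add_one_iff {i l : Fin k} (h : (i : ℕ) + 1 < k) :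
    l < ⟨(i : ℕ) + 1, h⟩ ↔ l < i ∨ i = l := by
  simp only [Fin.lt_def, Fin.ext_iff]; omega

theorem add_one_le_iff {i l : Fin k} (h : (i : ℕ) + 1 < k) :
    ⟨(i : ℕ) + 1, h⟩ ≤ l ↔ i ≤ l ∧ i ≠ l := by
  simp only [Fin.le_def, ne_eq, Fin.ext_iff]; omega

variable [NeZero k]

/-- Reduces the update of the open requests to propositional conditions on the vertex being left;
`h2` and `h2'` say that a request made there is the one prescribed by `b`. -/
theorem Pending.openRequests {b : Fin k → Bool} {s : RRMemory (2 * k + 1)} {Z : Prop}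
    {L : Fin k → Prop} (h : Pending b s.1 Z L) {u : Vertex k} (hu : u ≠ .y) {Z' : Prop}
    {L' : Fin k → Prop} (h0 : (Z ∨ u = .a 0) ∧ u ≠ .w 0 ↔ Z')
    (h1 : ∀ l, b l = true → ((L l ∨ u = .p l) ∧ u ≠ .r l ↔ L' l))
    (h1' : ∀ l, b l = false → ((L l ∨ u = .p' l) ∧ u ≠ .r' l ↔ L' l))
    (h2 : ∀ l, u = .p l → b l = true) (h2' : ∀ l, u = .p' l → b l = false) :
    Pending b ((gammaGame k).openRequests s u) Z' L' where
  zero := by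
    rw [zero_mem_openRequests, h.zero]
    tauto
  req l := by
    rw [reqIdx_mem_openRequests, h.req]
    have := h1 l
    have := h2 l
    tauto
  req' l := by
    rw [reqIdx'_mem_openRequests, h.req']
    have := h1' l
    have := h2' l
    tauto

/-- The memory content `s` at the vertex `u` of the play described by `b`. -/
def Tracks (b : Fin k → Bool) (s : RRMemory (2 * k + 1)) : Vertex k → Prop
  | .a i => s.2.2 = false ∧ s.2.1 = 0 ∧ Pending b s.1 (i ≠ 0) (· < i)
  | .p i => s.2.2 = false ∧ b i = true ∧ s.2.1 = 0 ∧ Pending b s.1 True (· < i)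
  | .p' i => s.2.2 = false ∧ b i = false ∧ s.2.1 = 0 ∧ Pending b s.1 True (· < i)
  | .w i => s.2.2 = false ∧ (s.2.1 : ℕ) = 2 * i ∧ Pending b s.1 (i = 0) (i ≤ ·)
  | .r i => s.2.2 = false ∧ b i = true ∧ (s.2.1 : ℕ) = 2 * i + 1 ∧ Pending b s.1 False (i ≤ ·)
  | .r' i => s.2.2 = false ∧ b i = false ∧ (s.2.1 : ℕ) = 2 * i + 1 ∧ Pending b s.1 False (i ≤ ·)
  | .x => s.2.2 = false ∧ (s.2.1 : ℕ) = 2 * k ∧ Pending b s.1 False (fun _ => False)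
  | .y => True

theorem mk_add_one_ne_zero {i : Fin k} (h : (i : ℕ) + 1 < k) : (⟨(i : ℕ) + 1, h⟩ : Fin k) ≠ 0 :=
  fun e => by simpa using congrArg Fin.val e

/-- In the first half the marker waits at pair 0. In the second half it moves at every step: on
leaving a vertex, the pair it points to has been answered in time or was never requested. -/
theorem Tracks.update {b : Fin k → Bool} {s : RRMemory (2 * k + 1)} {u : Vertex k}
    (h : Tracks b s u) : Tracks b ((gammaGame k).update s u) (u.next b) := by
  have hk : 0 < k := Nat.pos_of_ne_zero (NeZero.ne k)
  cases u with
  | a i =>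
    obtain ⟨-, hm, hp⟩ := h
    have hf := flag_update_of_lt (s := s) (.a i) (by simp [hm, hk])
    have hp' : Pending b ((gammaGame k).openRequests s (.a i)) True (· < i) := by
      apply hp.openRequests <;> simp [em']
    -- Pair 0, requested at `a 0` and not answered before `w 0`, holds the marker.
    have hm' := marker_of_mem (s := s) (u := .a i) (by rw [hm]; exact hp'.zero.2 trivial)
    rw [hm] at hm'
    cases hb : b i <;> simp only [Vertex.next, hb] <;> exact ⟨hf, hb, hm', hp'⟩
  | p i =>
    obtain ⟨-, hb, hm, hp⟩ := h
    have hf := flag_update_of_lt (s := s) (.p i) (by simp [hm, hk])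
    have hp' : Pending b ((gammaGame k).openRequests s (.p i)) True (fun l => l < i ∨ i = l) := by
      apply hp.openRequests <;> simp <;> grind
    have hm' := marker_of_mem (s := s) (u := .p i) (by rw [hm]; exact hp'.zero.2 trivial)
    rw [hm] at hm'
    by_cases hi : (i : ℕ) + 1 < k <;> simp only [Vertex.next, hi, dite_true, dite_false]
    · exact ⟨hf, hm', by simpa [RRGame.update, lt_add_one_iff hi, mk_add_one_ne_zero hi] using hp'⟩
    · refine ⟨hf, by simp [RRGame.update, hm'], ?_⟩
      have : ∀ l : Fin k, (l < i ∨ i = l) ↔ 0 ≤ l := fun l => by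
        simp only [Fin.lt_def, Fin.ext_iff, Fin.le_def]; simp; omega
      simpa [RRGame.update, this] using hp'
  | p' i =>
    obtain ⟨-, hb, hm, hp⟩ := h
    have hf := flag_update_of_lt (s := s) (.p' i) (by simp [hm, hk])
    have hp' : Pending b ((gammaGame k).openRequests s (.p' i)) True (fun l => l < i ∨ i = l) := by
      apply hp.openRequests <;> simp <;> grind
    have hm' := marker_of_mem (s := s) (u := .p' i) (by rw [hm]; exact hp'.zero.2 trivial)
    rw [hm] at hm'
    by_cases hi : (i : ℕ) + 1 < k <;> simp only [Vertex.next, hi, dite_true, dite_false]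
    · exact ⟨hf, hm', by simpa [RRGame.update, lt_add_one_iff hi, mk_add_one_ne_zero hi] using hp'⟩
    · refine ⟨hf, by simp [RRGame.update, hm'], ?_⟩
      have : ∀ l : Fin k, (l < i ∨ i = l) ↔ 0 ≤ l := fun l => by
        simp only [Fin.lt_def, Fin.ext_iff, Fin.le_def]; simp; omega
      simpa [RRGame.update, this] using hp'
  | w i =>
    obtain ⟨-, hm, hp⟩ := h
    have hf := flag_update_of_lt (s := s) (.w i) (by omega)
    have hp' : Pending b ((gammaGame k).openRequests s (.w i)) False (i ≤ ·) := by
      apply hp.openRequests <;> simp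
    have hm' : ((gammaGame k).marker s (.w i) : ℕ) = 2 * i + 1 := by
      rw [← hm]
      refine val_marker_of_notMem (by omega) ?_
      -- At `w 0` the marker points to pair 0, which is answered there. At a later `w i` it points
      -- to `reqIdx' (i - 1)`, which is not open since only indices from `i` on are still pending.
      by_cases hi : i = 0
      · have : s.2.1 = 0 := Fin.ext (by simpa [hi] using hm)
        rw [this, hp'.zero]
        exact id
      · have hi0 : (i : ℕ) ≠ 0 := fun h => hi (Fin.ext (by simpa using h))
        have : s.2.1 = reqIdx' ⟨i - 1, by omega⟩ :=
          Fin.ext (by simp only [reqIdx', hm]; omega)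
        rw [this, hp'.req', Fin.le_def]
        simp only
        omega
    cases hb : b i <;> simp only [Vertex.next, hb] <;> exact ⟨hf, hb, hm', hp'⟩
  | r i =>
    obtain ⟨-, hb, hm, hp⟩ := h
    have hp' : Pending b ((gammaGame k).openRequests s (.r i)) False (fun l => i ≤ l ∧ i ≠ l) := by
      apply hp.openRequests <;> simp
      grind
    have hf := flag_update_of_lt (s := s) (.r i) (by omega)
    have hm' : ((gammaGame k).marker s (.r i) : ℕ) = 2 * i + 1 + 1 := by
      rw [← hm]
      refine val_marker_of_notMem (by omega) ?_
      -- On leaving `r i` the index `i` is no longer pending, so the marker is free to pass;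
      -- likewise at `r' i`.
      rw [show s.2.1 = reqIdx i from Fin.ext hm, hp'.req]
      simp
    by_cases hi : (i : ℕ) + 1 < k <;> simp only [Vertex.next, hi, dite_true, dite_false]
    · exact ⟨hf, by simp only [RRGame.update, hm']; ring,
        by simpa [RRGame.update, add_one_le_iff hi, mk_add_one_ne_zero hi] using hp'⟩
    · have : ∀ l : Fin k, ¬ (i ≤ l ∧ i ≠ l) := fun l => by
        simp only [Fin.le_def, ne_eq, Fin.ext_iff]; omega
      refine ⟨hf, by simp only [RRGame.update, hm']; omega, ?_⟩
      simpa only [RRGame.update, this] using hp'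
  | r' i =>
    obtain ⟨-, hb, hm, hp⟩ := h
    have hp' : Pending b ((gammaGame k).openRequests s (.r' i)) False
        (fun l => i ≤ l ∧ i ≠ l) := by
      apply hp.openRequests <;> simp
      grind
    have hf := flag_update_of_lt (s := s) (.r' i) (by omega)
    have hm' : ((gammaGame k).marker s (.r' i) : ℕ) = 2 * i + 1 + 1 := by
      rw [← hm]
      refine val_marker_of_notMem (by omega) ?_
      rw [show s.2.1 = reqIdx i from Fin.ext hm, hp'.req]
      simp
    by_cases hi : (i : ℕ) + 1 < k <;> simp only [Vertex.next, hi, dite_true, dite_false]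
    · exact ⟨hf, by simp only [RRGame.update, hm']; ring,
        by simpa [RRGame.update, add_one_le_iff hi, mk_add_one_ne_zero hi] using hp'⟩
    · have : ∀ l : Fin k, ¬ (i ≤ l ∧ i ≠ l) := fun l => by
        simp only [Fin.le_def, ne_eq, Fin.ext_iff]; omega
      refine ⟨hf, by simp only [RRGame.update, hm']; omega, ?_⟩
      simpa only [RRGame.update, this] using hp'
  | x => trivial
  | y => trivial

/-- On the tracked plays, a final vertex is reached together with `y`. -/
theorem Tracks.mem_attr {b : Fin k → Bool} (n : ℕ) :
    ∀ (s : RRMemory (2 * k + 1)) (u : Vertex k), Tracks b s u → u.rank = n + 1 → n ≤ 2 * k →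
      (s, u) ∈ (gammaGame k).buchi.attr (gammaGame k).buchi.F (n + 1) := by
  induction n with
  | zero =>
    intro s u h hu _
    have hx : u = .x := by cases u <;> simp [Vertex.rank] at hu ⊢ <;> omega
    subst hx
    obtain ⟨-, hm, hp⟩ := h
    refine Or.inr ⟨fun ⟨i, h⟩ => (by cases h), ?_⟩
    rintro ⟨s', u'⟩ ⟨rfl, -⟩
    have hp' : Pending b ((gammaGame k).openRequests s .x) False (fun _ => False) := by
      apply hp.openRequests <;> simp
    have hl : s.2.1 = Fin.last (2 * k) := Fin.ext hm
    have hk : 0 < k := Nat.pos_of_ne_zero (NeZero.ne k)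
    -- The marker is at the last pair `reqIdx' (k - 1)`, which is closed, so the move from `x` to
    -- `y` wraps it and sets the flag.
    have hn : s.2.1 ∉ (gammaGame k).openRequests s .x := by
      rw [show s.2.1 = reqIdx' ⟨k - 1, by omega⟩ from
        Fin.ext (by simp only [reqIdx', hm]; omega), hp'.req']
      simp
    change ((gammaGame k).update s .x).2.2 = true
    simp only [RRGame.update, marker_of_notMem hn]
    simp [hl]
  | succ n ih =>
    intro s u h hu hn
    have hy : u ≠ .y := by rintro rfl; simp [Vertex.rank] at hu
    have hr := Vertex.rank_add_one (Vertex.edge_next b u) hy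
    have := ih _ _ h.update (by omega) (by omega)
    by_cases hw : ∃ i, u = .w i
    · exact Or.inl (Or.inr ⟨hw, ((gammaGame k).update s u, u.next b),
        ⟨rfl, Vertex.edge_next b u⟩, this⟩)
    · refine Or.inr ⟨hw, ?_⟩
      rintro ⟨s', u'⟩ ⟨h1, h2⟩
      change Edge u u' at h2
      rw [show s' = (gammaGame k).update s u from h1,
        Vertex.eq_next_of_edge b h2 (by omega) (not_exists.1 hw)]
      exact this

/-! ### Lower bounds for the attractor distance -/

/-- A final vertex cannot be reached before the marker has passed all pairs. -/
theorem notMem_attr_of_marker {s : RRMemory (2 * k + 1)} {u : Vertex k} {n : ℕ}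
    (hf : s.2.2 = false) (hn : n < u.rank) (hm : s.2.1 + u.rank ≤ 2 * k + 1) :
    (s, u) ∉ (gammaGame k).buchi.attr (gammaGame k).buchi.F n := by
  refine Arena.notMem_attr _ _ (fun n => {q | q.1.2.2 = false ∧ n < q.2.rank ∧
    (q.1.2.1 : ℕ) + q.2.rank ≤ 2 * k + 1}) exists_buchi_edge ?_ ?_ ?_ n _ ⟨hf, hn, hm⟩
  · rintro n q ⟨h, -⟩ (h' : q.1.2.2 = true)
    simp [h] at h'
  · exact fun m n hmn q h => ⟨h.1, hmn.trans_lt h.2.1, h.2.2⟩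
  · rintro n ⟨s, u⟩ ⟨-, h2, h3⟩ ⟨s', u'⟩ ⟨h, hE⟩
    obtain rfl : s' = (gammaGame k).update s u := h
    simp only at h2 h3
    have hr := Vertex.rank_add_one (u := u) (u' := u') hE (by rintro rfl; simp [Vertex.rank] at h2)
    have := val_marker_le s u
    -- Here the rank is at least 2, so the bound on the sum keeps the marker below its last value
    -- and the flag stays off. The sum does not grow, as the rank drops by one and the marker gains
    -- at most one.
    refine ⟨flag_update_of_lt u (by omega), by simp only; omega, ?_⟩
    simp only [RRGame.update]
    omega

/-- A final vertex cannot be reached before a pending request that the marker has not passed is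
answered. -/
theorem notMem_attr_of_pending {s : RRMemory (2 * k + 1)} {u : Vertex k} {n : ℕ}
    {j : Fin (2 * k + 1)} {i : Fin k} (hj : j = reqIdx i ∨ j = reqIdx' i)
    (hu : u.rank + 2 * i ≤ 2 * k) (huj : u ∉ (gammaGame k).R j)
    (hf : s.2.2 = false) (hn : n ≤ u.rank) (hs : j ∈ s.1) (hm : s.2.1 ≤ j) :
    (s, u) ∉ (gammaGame k).buchi.attr (gammaGame k).buchi.F n := by
  -- The vertices `r i` and `r' i` have rank `2 * k - 2 * i`; below that rank only `y` can answer
  -- `j`.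
  have hR : ∀ v : Vertex k, v.rank + 2 * i < 2 * k → v ∈ (gammaGame k).R j → v = .y := by
    rintro v hv (h | ⟨l, rfl, -, h⟩ | ⟨l, rfl, h⟩ | ⟨l, rfl, h⟩)
    · exact h
    · rcases hj with rfl | rfl <;> simp [reqIdx, reqIdx'] at h
    · simp only [Vertex.rank] at hv
      rcases hj with rfl | rfl <;> simp only [reqIdx, reqIdx'] at h <;> omega
    · simp only [Vertex.rank] at hv
      rcases hj with rfl | rfl <;> simp only [reqIdx, reqIdx'] at h <;> omega
  refine Arena.notMem_attr _ _ (fun n => {q | q.1.2.2 = false ∧ n ≤ q.2.rank ∧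
    q.2.rank + 2 * i ≤ 2 * k ∧ (q.2 ∈ (gammaGame k).R j → q.2 = .y) ∧
    j ∈ q.1.1 ∧ q.1.2.1 ≤ j}) exists_buchi_edge ?_ ?_ ?_ n _
    ⟨hf, hn, hu, fun h => absurd h huj, hs, hm⟩
  · rintro n q ⟨h, -⟩ (h' : q.1.2.2 = true)
    simp [h] at h'
  · exact fun m n hmn q h => ⟨h.1, hmn.trans h.2.1, h.2.2⟩
  · rintro n ⟨s, u⟩ ⟨-, h2, h3, h4, h5, h6⟩ ⟨s', u'⟩ ⟨h, hE⟩
    obtain rfl : s' = (gammaGame k).update s u := h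
    simp only at h2 h3 h4 h5 h6
    have hy : u ≠ .y := by rintro rfl; simp [Vertex.rank] at h2
    have hr := Vertex.rank_add_one (u := u) (u' := u') hE hy
    have hmem : j ∈ (gammaGame k).openRequests s u := ⟨Or.inl h5, fun h => hy (h4 h)⟩
    have hmark : (gammaGame k).marker s u ≤ j := by
      rcases h6.eq_or_lt with h | h
      · rw [marker_of_mem (by rwa [h]), h]
      · have := val_marker_le s u
        rw [Fin.le_def]
        rw [Fin.lt_def] at h
        omega
    refine ⟨?_, by simp only; omega, by simp only; omega, hR u' (by omega), hmem, hmark⟩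
    simp only [RRGame.update, decide_eq_false_iff_not]
    rintro ⟨h, h'⟩
    -- The flag is set only when the marker leaves the last value. As the marker is at most `j`, it
    -- would then equal `j`, whose open request keeps it from moving.
    have hjs : j = s.2.1 := le_antisymm (by rw [Fin.le_def]; omega) h6
    rw [marker_of_mem (hjs ▸ hmem)] at h'
    simp [h'] at h
    exact NeZero.ne k h

/-- The distance from `w i` to a final vertex is exactly `2 * k - 2 * i + 1`. The wrong successor
has rank `2 * k - 2 * i` and an open request that blocks the marker, so it is not within `2 * k - 2
* i` moves of `F` and does not decrease the distance. -/
theorem attractorStrategy_w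
    {g : RRMemory (2 * k + 1) × Vertex k → RRMemory (2 * k + 1) × Vertex k}
    (hg : (gammaGame k).buchi.IsAttractorStrategy g) {b : Fin k → Bool}
    {s : RRMemory (2 * k + 1)} {i : Fin k} (h : Tracks b s (.w i)) :
    (g (s, .w i)).2 = (Vertex.w i).next b := by
  have hV : (s, Vertex.w i) ∈ (gammaGame k).buchi.V₀ := ⟨i, rfl⟩
  have hrank : (Vertex.w i).rank = (2 * k - 2 * i) + 1 := by simp only [Vertex.rank]; omega
  have h1 := h.mem_attr _ _ _ hrank (by omega)
  have h2 : (s, Vertex.w i) ∉ (gammaGame k).buchi.attr (gammaGame k).buchi.F (2 * k - 2 * i) :=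
    notMem_attr_of_marker h.1 (by omega) (by rw [hrank, h.2.1]; omega)
  have h3 := hg.decrease _ hV (2 * k - 2 * i)
  rw [recur_gammaGame] at h3
  replace h3 := h3 h1 h2
  have hE := hg.edge _ hV
  generalize g (s, .w i) = q at h3 hE
  obtain ⟨s', u'⟩ := q
  obtain ⟨e, hE⟩ := hE
  obtain rfl : s' = (gammaGame k).update s (.w i) := e
  change Edge _ _ at hE
  -- The update depends only on the vertex being left, so the facts tracked for the right successor
  -- also describe the memory at the wrong one.
  have hs := h.update
  generalize (gammaGame k).update s (.w i) = t at h3 hs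
  cases hb : b i <;> simp only [Vertex.next, hb] at hs ⊢
  · cases hE with
    | response' => rfl
    | response =>
      obtain ⟨hf, -, hm, hp⟩ := hs
      refine absurd h3 (notMem_attr_of_pending (j := reqIdx' i) (i := i) (Or.inr rfl)
        (by simp only [Vertex.rank]; omega) ?_ hf le_rfl ((hp.req' i).2 ⟨le_rfl, hb⟩) ?_)
      · simp [gammaGame, reqIdx']
      · rw [Fin.le_def, hm]; simp [reqIdx']
  · cases hE with
    | response => rfl
    | response' =>
      obtain ⟨hf, -, hm, hp⟩ := hs
      refine absurd h3 (notMem_attr_of_pending (j := reqIdx i) (i := i) (Or.inl rfl)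
        (by simp only [Vertex.rank]; omega) ?_ hf le_rfl ((hp.req i).2 ⟨le_rfl, hb⟩) ?_)
      · simp [gammaGame, reqIdx]
      · rw [Fin.le_def, hm]; simp [reqIdx]

/-! ### The number of states of an implementation -/

/-- The play described by `b`. -/
def play (b : Fin k → Bool) (n : ℕ) : Vertex k := (Vertex.next b)^[n] (.a 0)

theorem play_succ (b : Fin k → Bool) (n : ℕ) : play b (n + 1) = (play b n).next b :=
  Function.iterate_succ_apply' _ _ _

theorem isPath_play (b : Fin k → Bool) : (gammaGame k).IsPath (play b) := fun n => by
  rw [play_succ]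
  exact Vertex.edge_next b _

/-- The fold runs over the past without the current vertex, which is the memory content with which
the strategy automaton produces its output there. -/
theorem tracks_play (b : Fin k → Bool) (n : ℕ) :
    Tracks b ((past (play b) n).foldl (gammaGame k).update (RRMemory.start (2 * k + 1)))
      (play b n) := by
  induction n with
  | zero =>
    refine ⟨rfl, rfl, ?_, fun l => ?_, fun l => ?_⟩ <;> simp [past, RRMemory.start]
  | succ n ih =>
    rw [past_succ, List.foldl_append, play_succ]
    exact ih.update

theorem conforms_play {g : RRMemory (2 * k + 1) × Vertex k → RRMemory (2 * k + 1) × Vertex k}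
    (hg : (gammaGame k).buchi.IsAttractorStrategy g) (b : Fin k → Bool) :
    (gammaGame k).Conforms ((gammaGame k).strategyAutomaton g).toStrategy (play b) := by
  rintro n ⟨i, hi⟩
  have := tracks_play b n
  rw [hi] at this
  rw [play_succ, hi]
  exact (attractorStrategy_w hg this).symm

theorem play_two_mul (b : Fin k → Bool) (i : ℕ) (hi : i < k) : play b (2 * i) = .a ⟨i, hi⟩ := by
  induction i with
  | zero => rfl
  | succ i ih =>
    rw [show 2 * (i + 1) = 2 * i + 1 + 1 by ring, play_succ, play_succ, ih (by omega)]
    cases hb : b ⟨i, by omega⟩ <;> simp [Vertex.next, hb, hi]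

theorem play_two_mul_add (b : Fin k → Bool) (i : ℕ) (hi : i < k) :
    play b (2 * k + 2 * i) = .w ⟨i, hi⟩ := by
  induction i with
  | zero =>
    obtain ⟨m, rfl⟩ : ∃ m, k = m + 1 := ⟨k - 1, by omega⟩
    rw [show 2 * (m + 1) + 2 * 0 = 2 * m + 1 + 1 by ring, play_succ, play_succ,
      play_two_mul b m (by omega)]
    cases hb : b ⟨m, by omega⟩ <;> simp [Vertex.next, hb]
  | succ i ih =>
    rw [show 2 * k + 2 * (i + 1) = 2 * k + 2 * i + 1 + 1 by ring, play_succ, play_succ,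
      ih (by omega)]
    cases hb : b ⟨i, by omega⟩ <;> simp [Vertex.next, hb, hi]

/-- If two plays leave `C` in the same state at `w 0`, then its outputs there agree. The plays
follow these outputs, so they visit the same vertices up to `w 1` and the states agree again. By
induction all answers agree, and the answers determine `b`. -/
theorem two_pow_le_card
    {g : RRMemory (2 * k + 1) × Vertex k → RRMemory (2 * k + 1) × Vertex k}
    (hg : (gammaGame k).buchi.IsAttractorStrategy g) {M : Type} [Finite M]
    (C : Mealy (Vertex k) M)
    (hC : C.Implements (gammaGame k).toArena
      ((gammaGame k).strategyAutomaton g).toStrategy (.a 0)) : 2 ^ k ≤ Nat.card M := by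
  have out : ∀ b n i, play b n = .w i →
      C.out ((past (play b) n).foldl C.step C.init) (.w i) = (Vertex.w i).next b := by
    intro b n i hi
    have h1 := hC _ (isPath_play b) rfl (conforms_play hg b) n ⟨i, hi⟩
    rw [← conforms_play hg b n ⟨i, hi⟩, play_succ, hi] at h1
    exact h1
  have inj : Function.Injective fun b : Fin k → Bool =>
      (past (play b) (2 * k)).foldl C.step C.init := by
    intro b b' (h : (past (play b) (2 * k)).foldl C.step C.init =
      (past (play b') (2 * k)).foldl C.step C.init)
    have key : ∀ i (hi : i < k), (past (play b) (2 * k + 2 * i)).foldl C.step C.init =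
        (past (play b') (2 * k + 2 * i)).foldl C.step C.init →
        (Vertex.w ⟨i, hi⟩).next b = (Vertex.w ⟨i, hi⟩).next b' := fun i hi e => by
      rw [← out b _ _ (play_two_mul_add b i hi), ← out b' _ _ (play_two_mul_add b' i hi), e]
    have states : ∀ i < k, (past (play b) (2 * k + 2 * i)).foldl C.step C.init =
        (past (play b') (2 * k + 2 * i)).foldl C.step C.init := by
      intro i hi
      induction i with
      | zero => exact h
      | succ i ih =>
        have hi' : i < k := by omega
        have e := ih hi'
        rw [show 2 * k + 2 * (i + 1) = 2 * k + 2 * i + 1 + 1 by ring]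
        simp only [past_succ, List.foldl_append, e, play_succ, play_two_mul_add _ i hi',
          key i hi' e]
    ext i
    have := key i i.2 (states i i.2)
    cases hb : b i <;> cases hb' : b' i <;> simp [Vertex.next, hb, hb'] at this ⊢
  have := Nat.card_le_card_of_injective _ inj
  simpa using this

end Tracking

/-! ### The memory reduction -/

section Reduction

variable {k : ℕ}

/-- The run of the simulating Büchi game through the vertices of the moves of a history. -/
noncomputable def followRun (s : RRMemory (2 * k + 1)) (v : Vertex k) :
    List (SpoilerMove (LiveState (RRMemory (2 * k + 1)) (Vertex k)) (Vertex k)) →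
      RRMemory (2 * k + 1) × Vertex k
  | [] => (s, v)
  | m :: h => ((gammaGame k).update (followRun s v h).1 (followRun s v h).2, m.2.1)

theorem automaton_step {q : RRMemory (2 * k + 1) × Vertex k} {v : Vertex k}
    {q' : LiveState (RRMemory (2 * k + 1)) (Vertex k)} :
    (gammaGame k).automaton.Δ (LiveState.mem q.1 q.2) v q' ↔
      Edge q.2 v ∧ q' = LiveState.mem ((gammaGame k).update q.1 q.2) v := by
  obtain ⟨q', hq'⟩ := q'
  constructor
  · intro h
    change gaStep _ _ _ (GAState.mem q.1 q.2) v q' at h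
    cases h with
    | edge _ _ s' _ h =>
      obtain ⟨h1, h2⟩ := h
      obtain rfl : s' = (gammaGame k).update q.1 q.2 := h1
      exact ⟨h2, rfl⟩
    | noEdge => exact absurd rfl hq'
  · rintro ⟨h, e⟩
    rw [e]
    exact gaStep.edge _ _ _ _ ⟨rfl, h⟩

/-- Duplicator follows the letters of Spoiler. -/
theorem duplicatorWins_of_isPath (sides : Set Bool)
    (W : (ℕ → LiveState (RRMemory (2 * k + 1)) (Vertex k)) →
      (ℕ → LiveState (RRMemory (2 * k + 1)) (Vertex k)) → Prop)
    (hW : ∀ ρ ρ' : ℕ → RRMemory (2 * k + 1) × Vertex k, (gammaGame k).buchi.IsPath ρ →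
      (gammaGame k).buchi.IsPath ρ' →
      W (fun n => LiveState.mem (ρ n).1 (ρ n).2) (fun n => LiveState.mem (ρ' n).1 (ρ' n).2))
    (s s' : RRMemory (2 * k + 1)) (v : Vertex k) :
    DuplicatorWins (gammaGame k).automaton.Δ sides W (LiveState.mem s v) (LiveState.mem s' v) := by
  let st : RRMemory (2 * k + 1) × Vertex k → LiveState (RRMemory (2 * k + 1)) (Vertex k) :=
    fun q => LiveState.mem q.1 q.2
  let d : List (SpoilerMove (LiveState (RRMemory (2 * k + 1)) (Vertex k)) (Vertex k)) →
      LiveState (RRMemory (2 * k + 1)) (Vertex k) := fun h => match h with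
    | [] => LiveState.mem s v
    | (false, a, p) :: h => st (followRun s' v ((false, a, p) :: h))
    | (true, a, p) :: h => st (followRun s v ((true, a, p) :: h))
  have snd : ∀ h, (followRun s v h).2 = (followRun s' v h).2 := by
    rintro (_ | ⟨m, h⟩) <;> rfl
  -- Transitions between live states are deterministic, so the state in a legal move of Spoiler is
  -- determined by its letter.
  have pos : ∀ h, IsHistory (gammaGame k).automaton.Δ sides d (st (s, v)) (st (s', v)) h →
      positions d (st (s, v)) (st (s', v)) h = (st (followRun s v h), st (followRun s' v h)) := by
    intro h
    induction h with
    | nil => exact fun _ => rfl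
    | cons m h ih =>
      rintro ⟨h1, -, h3⟩
      obtain ⟨b, a, p⟩ := m
      rw [ih h1] at h3
      cases b
      · have := (automaton_step.1 h3).2
        exact Prod.ext this rfl
      · have := (automaton_step.1 h3).2
        exact Prod.ext rfl this
  have edge : ∀ m h, IsHistory (gammaGame k).automaton.Δ sides d (st (s, v)) (st (s', v)) (m :: h) →
      Edge (followRun s v h).2 m.2.1 := by
    rintro ⟨b, a, p⟩ h ⟨h1, -, h3⟩
    rw [pos h h1] at h3
    cases b
    · exact (automaton_step.1 h3).1
    · rw [snd]
      exact (automaton_step.1 h3).1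
  refine ⟨d, ?_, ?_⟩
  · intro m h hm
    have he := edge m h hm
    change (gammaGame k).automaton.Δ (side _ (positions d (st (s, v)) (st (s', v)) h)) _ _
    rw [pos h hm.1]
    obtain ⟨b, a, p⟩ := m
    cases b
    · exact automaton_step.2 ⟨snd h ▸ he, rfl⟩
    · exact automaton_step.2 ⟨he, rfl⟩
  · intro μ hμ
    have e : ∀ n, positions d (LiveState.mem s v) (LiveState.mem s' v) (histOf μ n) =
        (st (followRun s v (histOf μ n)), st (followRun s' v (histOf μ n))) :=
      fun n => pos _ (hμ n)
    simp only [e]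
    exact hW (fun n => followRun s v (histOf μ n)) (fun n => followRun s' v (histOf μ n))
      (fun n => ⟨rfl, edge _ _ (hμ (n + 1))⟩)
      (fun n => ⟨rfl, by have := edge _ _ (hμ (n + 1)); rw [snd] at this; exact this⟩)

/-- Induction on `potential`: each successor has smaller potential or is final. The initial state
follows because its successors are pairs of a memory content and a vertex. -/
theorem closure_F_gammaGame : (gammaGame k).automaton.closure.F = Set.univ := by
  have hmem : ∀ q : RRMemory (2 * k + 1) × Vertex k,
      (gammaGame k).automaton.InClosure (LiveState.mem q.1 q.2) := by
    intro q
    induction h : potential q using Nat.strong_induction_on generalizing q with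
    | _ d ih =>
      refine BuchiAutomaton.InClosure.step _ fun a q' hq' => ?_
      obtain ⟨he, rfl⟩ := automaton_step.1 hq'
      have hE : (gammaGame k).buchi.E q ((gammaGame k).update q.1 q.2, a) := ⟨rfl, he⟩
      rcases potential_decreases hE with h' | h'
      · exact ih _ (h ▸ h') _ rfl
      · refine BuchiAutomaton.InClosure.base _ ⟨_, _, rfl, ?_⟩
        rw [h']
        rfl
  refine Set.eq_univ_of_forall ?_
  rintro ⟨q, hq⟩
  cases q with
  | mem s v => exact hmem (s, v)
  | sink => exact absurd rfl hq
  | init =>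
    refine BuchiAutomaton.InClosure.step _ ?_
    rintro a ⟨q', hq'⟩ h
    change gaStep _ _ _ GAState.init a q' at h
    cases h
    exact hmem (_, a)

theorem directBisim_closure (s s' : RRMemory (2 * k + 1)) (v : Vertex k) :
    (gammaGame k).automaton.closure.DirectBisim (LiveState.mem s v) (LiveState.mem s' v) :=
  duplicatorWins_of_isPath _ _ (fun ρ ρ' _ _ i => by simp [closure_F_gammaGame]) s s' v

/-- The answering run visits final states infinitely often, hence after any given time, whatever the
other run does. -/
theorem delayedSim_gammaGame (s s' : RRMemory (2 * k + 1)) (v : Vertex k) :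
    (gammaGame k).automaton.DelayedSim (LiveState.mem s v) (LiveState.mem s' v) := by
  refine duplicatorWins_of_isPath _ _ (fun ρ ρ' _ h i _ => ?_) s s' v
  obtain ⟨j, hj, e⟩ := frequently_atTop.1 (frequently_final h) i
  exact ⟨j, hj, _, _, rfl, by rw [e]; rfl⟩

/-- The memory of a reduced game is the whole quotient type; the order on the memory contents
affects only the transitions. -/
theorem card_quotient_memSetoid {S V : Type} [Nonempty S] {r : Setoid (S × V)}
    (h : ∀ s s' v, r (s, v) (s', v)) : Nat.card (Quotient (memSetoid r)) = 1 := by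
  rw [Nat.card_eq_one_iff_unique]
  exact ⟨⟨Quotient.ind₂ fun s s' => Quotient.sound (h s s')⟩,
    ⟨Quotient.mk _ (Classical.arbitrary S)⟩⟩

end Reduction

/-! ### The main theorem -/

theorem mainTheorem1 (k : ℕ) [NeZero k] :
    -- the Büchi game simulates the request-response game, and Player 0 wins the latter from `v`
    Simulates (gammaGame k).toGame (RRMemory.start (2 * k + 1)) (gammaGame k).buchi.toGame ∧
    (gammaGame k).toGame.Wins (.a 0) ∧
    -- positional attractor strategies exist; each of them is winning from `(∅, 1, 0, v)` and yields
    -- a winning strategy from `v`, whose implementation needs at least `2 ^ k` memory contents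
    (∃ g, (gammaGame k).buchi.IsAttractorStrategy g) ∧
    (∀ g, (gammaGame k).buchi.IsAttractorStrategy g →
      (gammaGame k).buchi.toGame.IsWinningFrom (positional g) (RRMemory.start (2 * k + 1), .a 0) ∧
      (gammaGame k).toGame.IsWinningFrom ((gammaGame k).strategyAutomaton g).toStrategy (.a 0) ∧
      ∀ (M : Type) [Finite M] (C : Mealy (Vertex k) M),
        C.Implements (gammaGame k).toArena ((gammaGame k).strategyAutomaton g).toStrategy (.a 0) →
        2 ^ k ≤ Nat.card M) ∧
    -- every path in the Büchi game visits `(∅, 1, 1, y)` infinitely often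
    (∀ ρ, (gammaGame k).buchi.IsPath ρ →
      ∃ᶠ n in atTop, ρ n = (((∅, 0, true) : RRMemory (2 * k + 1)), Vertex.y)) ∧
    -- all states are final in the closure
    (gammaGame k).automaton.closure.F = Set.univ ∧
    -- the reduced game graph has exactly one memory content
    (∀ prec : RRMemory (2 * k + 1) → RRMemory (2 * k + 1) → Prop,
      IsStrictTotalOrder (RRMemory (2 * k + 1)) prec →
      Nat.card ((gammaGame k).memoryReduction prec).Mem = 1 ∧
      Nat.card ((gammaGame k).delayedReduction prec).Mem = 1) := by
  have hex : ∃ g : RRMemory (2 * k + 1) × Vertex k → RRMemory (2 * k + 1) × Vertex k,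
      (gammaGame k).buchi.IsAttractorStrategy g := exists_isAttractorStrategy_gammaGame
  refine ⟨simulates_gammaGame, ?_, hex, ?_, fun _ hρ => frequently_final hρ, closure_F_gammaGame,
    fun _ _ => ⟨?_, ?_⟩⟩
  · obtain ⟨g, hg⟩ := hex
    exact ⟨_, strategyAutomaton_isWinningFrom hg.edge (.a 0)⟩
  · intro g hg
    exact ⟨buchi_isWinningFrom hg.edge _, strategyAutomaton_isWinningFrom hg.edge _,
      fun M _ C hC => two_pow_le_card hg C hC⟩
  · exact card_quotient_memSetoid directBisim_closure
  · exact card_quotient_memSetoid fun s s' v =>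
      ⟨delayedSim_gammaGame s s' v, delayedSim_gammaGame s' s v⟩
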